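/- Let $X$ and $Y$ be real Banach spaces. Let $c_0(X)$ be the space of sequences in $X$ converging in norm to $0$, and let $\ell_\infty(Y)$ be the space of bounded sequences in $Y$, both with the supremum norm. For Banach spaces $E$ and $F$, write $E\hookrightarrow F$ if there are a bounded linear operator $T:E\to F$ and a constant $C>0$ with $C\|u\|\le\|T(u)\|$ for all $u\in E$. Suppose that $c_0(X)\not\hookrightarrow Y^n$ for every integer $n\ge 1$, where $Y^n$ carries the maximum norm. Then $\ell_\infty(Y)$ has no complemented subspace isomorphic to $c_0(X)$; that is, no subspace of $\ell_\infty(Y)$ which is the image of a bounded linear operator $P:\ell_\infty(Y)\to\ell_\infty(Y)$ with $P^2=P$ is linearly homeomorphic to $c_0(X)$. -/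

import Mathlib

/-- The space `c₀(X)` of null sequences in `X` with the supremum norm: functions `ℕ → X` (with `ℕ`
discrete) that vanish at infinity. -/
abbrev NullSeq (X : Type*) [NormedAddCommGroup X] : Type _ :=
  ZeroAtInftyContinuousMap ℕ X

/-- The space `ℓ∞(Y)` of bounded sequences in `Y` with the supremum norm. -/
abbrev BoundedSeq (Y : Type*) [NormedAddCommGroup Y] : Type _ :=
  lp (fun _ : ℕ => Y) (⊤ : ENNReal)

/-- `E ↪ F`: there is a bounded linear operator `T : E → F` that is bounded below. -/
def Embeds (E F : Type*) [NormedAddCommGroup E] [NormedSpace ℝ E]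
    [NormedAddCommGroup F] [NormedSpace ℝ F] : Prop :=
  ∃ (T : E →L[ℝ] F) (C : ℝ), 0 < C ∧ ∀ u : E, C * ‖u‖ ≤ ‖T u‖

/-- `E` is isomorphic to a complemented subspace of `F`: some subspace `M` of `F` is linearly
homeomorphic to `E` and is the image of a bounded linear projection of `F`. -/
def EmbedsComplemented (E F : Type*) [NormedAddCommGroup E] [NormedSpace ℝ E]
    [NormedAddCommGroup F] [NormedSpace ℝ F] : Prop :=
  ∃ M : Submodule ℝ F,
    (∃ P : F →L[ℝ] F, (∀ u, P (P u) = P u) ∧ (P : F →ₗ[ℝ] F).range = M) ∧ Nonempty (E ≃L[ℝ] M)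

/-!
Suppose `T : c₀(X) → ℓ∞(Y)` and `B : ℓ∞(Y) → c₀(X)` are bounded with `B ∘ T = id`. Splitting `ℕ` into
infinitely many infinite rows gives disjointly supported copies of `c₀(X)` inside itself. Since
`c₀(X)` does not embed in any `Y ^ n`, the `k`-th row contains a unit vector `v k` such that the first
`k + 1` coordinates of `T (v k)` are smaller than `2⁻ᵏ` (`exists_row_seq`). The vectors `v k` span a
copy of `c₀`, and each coordinate of `∑ a k • T (v k)` converges absolutely for every bounded scalar
sequence `a`, not only for null sequences. So `T` on this copy of `c₀` extends to a bounded operator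
`S : ℓ∞ → ℓ∞(Y)` (`exists_clm_eq_tsum`). Following `B ∘ S` by functionals biorthogonal to the `v k`
gives a bounded operator `ℓ∞ → c₀` that fixes the finitely supported sequences, which is impossible by
Phillips' theorem (`exists_not_tendsto_of_eq_on_finite_support`).

Phillips' theorem is obtained by Whitley's argument. A functional on `ℓ∞` that vanishes on finitely
supported sequences is nonzero on the indicators of at most countably many members of an almost
disjoint family (`countable_apply_indicatorSeq_ne_zero`). As there are uncountable almost disjoint
families of infinite sets, the operator would have to fix the indicator of some infinite set, which
is not a null sequence.
-/

open Filter Topology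

/-! ### An uncountable almost disjoint family -/

/-- The set of codes of the finite initial segments of the binary sequence `x`: for varying
`x`, an almost disjoint family of infinite subsets of `ℕ` indexed by the Cantor space. -/
def branchCodes (x : ℕ → Bool) : Set ℕ :=
  Set.range fun n : ℕ => Encodable.encode (List.ofFn fun i : Fin n => x i)

theorem branchCodes_infinite (x : ℕ → Bool) : (branchCodes x).Infinite := by
  refine Set.infinite_range_of_injective fun m n h => ?_
  simpa using congrArg List.length (Encodable.encode_injective h)

theorem branchCodes_inter_finite {x y : ℕ → Bool} (hxy : x ≠ y) :
    (branchCodes x ∩ branchCodes y).Finite := by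
  obtain ⟨p, hp⟩ := Function.ne_iff.1 hxy
  refine ((Set.finite_Iic p).image
    fun n : ℕ => Encodable.encode (List.ofFn fun i : Fin n => x i)).subset ?_
  rintro _ ⟨⟨n, rfl⟩, ⟨m, hm⟩⟩
  refine ⟨n, ?_, rfl⟩
  have h := Encodable.encode_injective hm
  have hmn : m = n := by simpa using congrArg List.length h
  subst hmn
  by_contra hlt
  exact hp (congrFun (List.ofFn_injective h) ⟨p, not_le.1 hlt⟩).symm

/-! ### Phillips' theorem: `c₀` is not complemented in `ℓ∞` -/

/-- The indicator of `A` as a bounded sequence. -/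
noncomputable def indicatorSeq (A : Set ℕ) : BoundedSeq ℝ :=
  ⟨A.indicator 1, memℓp_infty ⟨1, by
    rintro _ ⟨n, rfl⟩
    by_cases h : n ∈ A <;> simp [h]⟩⟩

theorem indicatorSeq_apply (A : Set ℕ) (n : ℕ) : indicatorSeq A n = A.indicator 1 n := rfl

/-- Off the finite set where two of the sets `A i`, `i ∈ s`, meet, a signed sum of their indicators
is bounded by one, and `φ` does not see the finite set. -/
theorem sum_abs_apply_indicatorSeq_le {ι : Type*} {A : ι → Set ℕ}
    (hA : Pairwise fun i j => (A i ∩ A j).Finite) (φ : BoundedSeq ℝ →L[ℝ] ℝ)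
    (hφ : ∀ a : BoundedSeq ℝ, (Function.support a).Finite → φ a = 0) (s : Finset ι) :
    ∑ i ∈ s, |φ (indicatorSeq (A i))| ≤ ‖φ‖ := by
  classical
  -- The signs are chosen so that `φ w` is the sum to be estimated.
  set c : ι → ℝ := fun i => (SignType.sign (φ (indicatorSeq (A i))) : ℝ) with hc
  have hc1 (i : ι) : ‖c i‖ ≤ 1 := by
    rcases lt_trichotomy (φ (indicatorSeq (A i))) 0 with h | h | h <;> simp [hc, h]
  set w : BoundedSeq ℝ := ∑ i ∈ s, c i • indicatorSeq (A i) with hw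
  have hwm (m : ℕ) : w m = ∑ i ∈ s, c i * (A i).indicator 1 m := by
    simp only [hw, lp.coeFn_sum, Finset.sum_apply, lp.coeFn_smul, Pi.smul_apply,
      indicatorSeq_apply, smul_eq_mul]
  set F : Set ℕ := ⋃ p ∈ s.offDiag, A p.1 ∩ A p.2 with hF
  have hFfin : F.Finite := s.offDiag.finite_toSet.biUnion fun p hp =>
    hA (Finset.mem_offDiag.1 hp).2.2
  have hv1 (m : ℕ) : ‖Fᶜ.indicator w m‖ ≤ 1 := by
    by_cases hm : m ∈ F
    · simp [hm]
    rw [Set.indicator_of_mem hm, hwm]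
    by_cases hex : ∃ i ∈ s, m ∈ A i
    · obtain ⟨i, hi, hmi⟩ := hex
      rw [Finset.sum_eq_single_of_mem i hi]
      · simpa [hmi] using hc1 i
      · intro l hl hli
        have : m ∉ A l := fun hml =>
          hm (Set.mem_iUnion₂.2 ⟨(l, i), Finset.mem_offDiag.2 ⟨hl, hi, hli⟩, hml, hmi⟩)
        simp [this]
    · push Not at hex
      rw [Finset.sum_eq_zero fun i hi => by simp [hex i hi]]
      simp
  set v : BoundedSeq ℝ := ⟨Fᶜ.indicator w, memℓp_infty ⟨1, by rintro _ ⟨m, rfl⟩; exact hv1 m⟩⟩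
    with hv
  have hwv : φ w = φ v := by
    rw [← sub_eq_zero, ← map_sub]
    refine hφ _ (hFfin.subset fun m hm => ?_)
    by_contra hmF
    refine hm ?_
    show w m - Fᶜ.indicator w m = 0
    rw [Set.indicator_of_mem hmF, sub_self]
  calc ∑ i ∈ s, |φ (indicatorSeq (A i))| = φ w := by
        rw [hw, map_sum]
        refine Finset.sum_congr rfl fun i _ => ?_
        rw [map_smul, smul_eq_mul, hc, sign_mul_self]
    _ = φ v := hwv
    _ ≤ ‖φ v‖ := Real.le_norm_self _
    _ ≤ ‖φ‖ * 1 := φ.le_opNorm_of_le (lp.norm_le_of_forall_le zero_le_one hv1)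
    _ = ‖φ‖ := mul_one _

theorem countable_apply_indicatorSeq_ne_zero {ι : Type*} {A : ι → Set ℕ}
    (hA : Pairwise fun i j => (A i ∩ A j).Finite) (φ : BoundedSeq ℝ →L[ℝ] ℝ)
    (hφ : ∀ a : BoundedSeq ℝ, (Function.support a).Finite → φ a = 0) :
    {i | φ (indicatorSeq (A i)) ≠ 0}.Countable := by
  have h := (summable_of_sum_le (fun i => abs_nonneg (φ (indicatorSeq (A i))))
    (sum_abs_apply_indicatorSeq_le hA φ hφ)).countable_support
  simpa [Function.support] using h

/-- Phillips' theorem, with the operator given by its coordinates `ψ k`: a bounded operator on `ℓ∞`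
that fixes all finitely supported sequences does not take values in `c₀`. No uniform bound on the
`ψ k` is needed. -/
theorem exists_not_tendsto_of_eq_on_finite_support (ψ : ℕ → BoundedSeq ℝ →L[ℝ] ℝ)
    (hψ : ∀ k, ∀ a : BoundedSeq ℝ, (Function.support a).Finite → ψ k a = a k) :
    ∃ a, ¬ Tendsto (fun k => ψ k a) atTop (𝓝 0) := by
  have hcount (k : ℕ) :
      {x | (lp.evalCLM ℝ (fun _ : ℕ => ℝ) ⊤ k - ψ k) (indicatorSeq (branchCodes x)) ≠ 0}.Countable :=
    countable_apply_indicatorSeq_ne_zero (fun x y h => branchCodes_inter_finite h) _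
      fun a ha => by
        show a k - ψ k a = 0
        rw [hψ k a ha, sub_self]
  obtain ⟨x, hx⟩ : ∃ x, x ∉ ⋃ k : ℕ, {x | (lp.evalCLM ℝ (fun _ : ℕ => ℝ) ⊤ k - ψ k)
      (indicatorSeq (branchCodes x)) ≠ 0} := by
    -- Otherwise the Cantor space is countable, and the diagonal argument applies.
    by_contra! hall
    have hc : (Set.univ : Set (ℕ → Bool)).Countable :=
      (Set.countable_iUnion hcount).mono fun x _ => hall x
    have := Set.countable_univ_iff.1 hc
    obtain ⟨f, hf⟩ := exists_surjective_nat (ℕ → Bool)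
    obtain ⟨n, hn⟩ := hf fun n => !f n n
    simpa using congrFun hn n
  refine ⟨indicatorSeq (branchCodes x), fun ht => ?_⟩
  have heq (k : ℕ) : ψ k (indicatorSeq (branchCodes x)) = (branchCodes x).indicator 1 k := by
    have h0 : indicatorSeq (branchCodes x) k - ψ k (indicatorSeq (branchCodes x)) = 0 :=
      not_not.1 fun h => hx (Set.mem_iUnion.2 ⟨k, h⟩)
    exact (sub_eq_zero.1 h0).symm
  obtain ⟨N, hN⟩ := eventually_atTop.1 (ht.eventually (gt_mem_nhds one_pos))
  obtain ⟨k, hk, hNk⟩ := (branchCodes_infinite x).exists_gt N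
  have := hN k hNk.le
  simp [heq, hk] at this

/-! ### Rows of `c₀(X)` -/

section NullSeq

variable {X : Type*} [NormedAddCommGroup X]

theorem NullSeq.norm_apply_le (u : NullSeq X) (n : ℕ) : ‖u n‖ ≤ ‖u‖ :=
  u.toBCF.norm_coe_le_norm n

theorem NullSeq.norm_le {u : NullSeq X} {C : ℝ} (hC : 0 ≤ C) (h : ∀ n, ‖u n‖ ≤ C) : ‖u‖ ≤ C :=
  (u.toBCF.norm_le hC).2 h

theorem NullSeq.tendsto_cofinite (u : NullSeq X) : Tendsto u cofinite (𝓝 0) := by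
  rw [← cocompact_eq_cofinite]
  exact zero_at_infty u

variable [NormedSpace ℝ X]

/-- Evaluation at the index `n`, as a bounded linear map on `c₀(X)`. -/
noncomputable def NullSeq.eval (n : ℕ) : NullSeq X →L[ℝ] X :=
  LinearMap.mkContinuous
    { toFun := fun u => u n
      map_add' := fun _ _ => rfl
      map_smul' := fun _ _ => rfl } 1 fun u => by simpa using NullSeq.norm_apply_le u n

theorem NullSeq.eval_apply (n : ℕ) (u : NullSeq X) : NullSeq.eval n u = u n := rfl

/-- The isometric copy of `c₀(X)` inside `c₀(X)` formed by the sequences supported in the `k`-th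
row of `ℕ ≃ ℕ × ℕ`. -/
noncomputable def NullSeq.row (k : ℕ) : NullSeq X →ₗᵢ[ℝ] NullSeq X where
  toFun u :=
    { toFun := fun m => if (Nat.unpair m).1 = k then u (Nat.unpair m).2 else 0
      continuous_toFun := continuous_of_discreteTopology
      zero_at_infty' := by
        rw [cocompact_eq_cofinite, Metric.tendsto_nhds]
        intro ε hε
        have h := (Metric.tendsto_nhds.1 u.tendsto_cofinite) ε hε
        rw [eventually_cofinite] at h ⊢
        refine (h.image (Nat.pair k)).subset fun m hm => ?_
        by_cases hk : (Nat.unpair m).1 = k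
        · refine ⟨(Nat.unpair m).2, by simpa [hk] using hm, ?_⟩
          rw [← hk, Nat.pair_unpair]
        · simp [hk] at hm
          exact absurd hm hε.not_ge }
  map_add' u v := by
    ext m
    by_cases hk : (Nat.unpair m).1 = k <;> simp [hk]
  map_smul' c u := by
    ext m
    by_cases hk : (Nat.unpair m).1 = k <;> simp [hk]
  norm_map' u := by
    refine le_antisymm (NullSeq.norm_le (norm_nonneg _) fun m => ?_)
      (NullSeq.norm_le (norm_nonneg _) fun n => ?_)
    · by_cases hk : (Nat.unpair m).1 = k
      · simpa [hk] using u.norm_apply_le _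
      · simp [hk]
    · refine le_trans (le_of_eq ?_) (NullSeq.norm_apply_le _ (Nat.pair k n))
      simp

theorem NullSeq.row_apply (k : ℕ) (u : NullSeq X) (m : ℕ) :
    NullSeq.row k u m = if (Nat.unpair m).1 = k then u (Nat.unpair m).2 else 0 := rfl

/-- Vectors in different rows have disjoint supports, which gives the upper `c₀`-estimate. -/
theorem NullSeq.norm_sum_smul_row_le {u : ℕ → NullSeq X} (hu : ∀ k, ‖u k‖ ≤ 1) {a : ℕ → ℝ} {r : ℝ}
    (hr : 0 ≤ r) (ha : ∀ k, ‖a k‖ ≤ r) (s : Finset ℕ) :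
    ‖∑ k ∈ s, a k • NullSeq.row k (u k)‖ ≤ r := by
  refine NullSeq.norm_le hr fun m => ?_
  rw [← NullSeq.eval_apply, map_sum]
  simp only [map_smul, NullSeq.eval_apply, NullSeq.row_apply, smul_ite, smul_zero,
    Finset.sum_ite_eq]
  split_ifs with h
  · rw [norm_smul]
    exact (mul_le_mul (ha _) (((u _).norm_apply_le _).trans (hu _)) (norm_nonneg _) hr).trans
      (mul_one r).le
  · simpa using hr

/-- A coordinate functional witnessing that the norm of `u` is one. The bound `2` leaves room for
choosing a coordinate with `‖u n‖ > 1 / 2`. -/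
theorem NullSeq.exists_functional_apply_eq_one {u : NullSeq X} (hu : ‖u‖ = 1) :
    ∃ (n : ℕ) (g : X →L[ℝ] ℝ), ‖g‖ ≤ 2 ∧ g (u n) = 1 := by
  obtain ⟨n, hn⟩ : ∃ n, 1 / 2 < ‖u n‖ := by
    by_contra! h
    have := NullSeq.norm_le (by norm_num) h
    norm_num [hu] at this
  obtain ⟨g, hg, hgu⟩ := exists_dual_vector'' ℝ (u n)
  have hpos : 0 < ‖u n‖ := lt_trans (by norm_num) hn
  refine ⟨n, ‖u n‖⁻¹ • g, ?_, ?_⟩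
  · rw [norm_smul, norm_inv, norm_norm]
    have : ‖u n‖⁻¹ ≤ 2 := by
      rw [inv_le_comm₀ hpos two_pos]
      linarith
    exact (mul_le_mul this hg (norm_nonneg _) zero_le_two).trans (mul_one _).le
  · have : g (u n) = ‖u n‖ := by simpa using hgu
    simp [this, hpos.ne']

end NullSeq

/-! ### Extending the copy of `c₀` to `ℓ∞` -/

theorem exists_norm_eq_one_of_not_embeds {E F : Type*} [NormedAddCommGroup E] [NormedSpace ℝ E]
    [NormedAddCommGroup F] [NormedSpace ℝ F] (h : ¬ Embeds E F) (T : E →L[ℝ] F) {ε : ℝ}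
    (hε : 0 < ε) : ∃ u, ‖u‖ = 1 ∧ ‖T u‖ < ε := by
  simp only [Embeds, not_exists, not_and, not_forall, not_le] at h
  obtain ⟨u, hu⟩ := h T ε hε
  have hu0 : 0 < ‖u‖ := by
    refine norm_pos_iff.2 ?_
    rintro rfl
    simp at hu
  refine ⟨‖u‖⁻¹ • u, ?_, ?_⟩
  · simp [norm_smul, hu0.ne']
  · rw [map_smul, norm_smul, norm_inv, norm_norm, inv_mul_lt_iff₀ hu0, mul_comm]
    exact hu

/-- If the sums `∑ a k • w k` over finite sets are bounded by a multiple of `‖a‖` and `w` is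
coordinatewise absolutely summable, then `a ↦ ∑ a k • w k`, with sums taken coordinatewise, is a
bounded operator from `ℓ∞` to `ℓ∞(Y)`. The series need not converge in norm. -/
theorem exists_clm_eq_tsum {Y : Type*} [NormedAddCommGroup Y] [NormedSpace ℝ Y] [CompleteSpace Y]
    {w : ℕ → BoundedSeq Y} {C : ℝ} (hC : 0 ≤ C)
    (hw : ∀ (a : BoundedSeq ℝ) (s : Finset ℕ), ‖∑ k ∈ s, a k • w k‖ ≤ C * ‖a‖)
    (hsum : ∀ j, Summable fun k => ‖w k j‖) :
    ∃ S : BoundedSeq ℝ →L[ℝ] BoundedSeq Y, ∀ a j, S a j = ∑' k, a k • w k j := by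
  have hs (a : BoundedSeq ℝ) (j : ℕ) : Summable fun k => a k • w k j := by
    refine Summable.of_norm_bounded ((hsum j).mul_left ‖a‖) fun k => ?_
    rw [norm_smul]
    exact mul_le_mul_of_nonneg_right (lp.norm_apply_le_norm ENNReal.top_ne_zero a k)
      (norm_nonneg _)
  have hb (a : BoundedSeq ℝ) (j : ℕ) : ‖∑' k, a k • w k j‖ ≤ C * ‖a‖ := by
    refine le_of_tendsto (hs a j).hasSum.norm (Eventually.of_forall fun s => ?_)
    refine le_trans (le_of_eq ?_)
      ((lp.norm_apply_le_norm ENNReal.top_ne_zero _ j).trans (hw a s))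
    simp only [lp.coeFn_sum, Finset.sum_apply, lp.coeFn_smul, Pi.smul_apply]
  refine ⟨LinearMap.mkContinuous
    { toFun := fun a => ⟨fun j => ∑' k, a k • w k j, memℓp_infty ⟨C * ‖a‖, ?_⟩⟩
      map_add' := fun a b => ?_
      map_smul' := fun c a => ?_ } C fun a => ?_, fun a j => rfl⟩
  · rintro _ ⟨j, rfl⟩
    exact hb a j
  · ext j
    show ∑' k, (a k + b k) • w k j = ∑' k, a k • w k j + ∑' k, b k • w k j
    simp only [add_smul]
    exact (hs a j).tsum_add (hs b j)
  · ext j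
    show ∑' k, (c * a k) • w k j = c • ∑' k, a k • w k j
    simp only [mul_smul]
    exact (hs a j).tsum_const_smul c
  · exact lp.norm_le_of_forall_le (by positivity) (hb a)

/-- The `k`-th vector is chosen in the `k`-th row with the first `k + 1` coordinates of its image
below `2⁻ᵏ`, so each coordinate `j` is controlled by a geometric series from `k = j` on. -/
theorem exists_row_seq {X Y : Type*} [NormedAddCommGroup X] [NormedSpace ℝ X]
    [NormedAddCommGroup Y] [NormedSpace ℝ Y]
    (h : ∀ n : ℕ, 1 ≤ n → ¬ Embeds (NullSeq X) (Fin n → Y))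
    (T : NullSeq X →L[ℝ] BoundedSeq Y) :
    ∃ u : ℕ → NullSeq X, (∀ k, ‖u k‖ = 1) ∧
      ∀ j, Summable fun k => ‖T (NullSeq.row k (u k)) j‖ := by
  have hex (k : ℕ) : ∃ u : NullSeq X, ‖u‖ = 1 ∧
      ‖((ContinuousLinearMap.pi fun i : Fin (k + 1) => lp.evalCLM ℝ (fun _ : ℕ => Y) ⊤ (i : ℕ)).comp
        (T.comp (NullSeq.row k).toContinuousLinearMap)) u‖ < (1 / 2) ^ k :=
    exists_norm_eq_one_of_not_embeds (h (k + 1) (Nat.le_add_left 1 k)) _ (by positivity)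
  choose u hu1 hu using hex
  refine ⟨u, hu1, fun j => ?_⟩
  refine Summable.of_norm_bounded_eventually_nat summable_geometric_two ?_
  filter_upwards [eventually_ge_atTop j] with k hk
  rw [norm_norm]
  exact (norm_le_pi_norm _ (⟨j, Nat.lt_succ_of_le hk⟩ : Fin (k + 1))).trans (hu k).le

/-- `c₀(X)` is not a retract of `ℓ∞(Y)` by bounded operators. -/
theorem not_leftInverse_nullSeq_boundedSeq {X Y : Type*} [NormedAddCommGroup X] [NormedSpace ℝ X]
    [NormedAddCommGroup Y] [NormedSpace ℝ Y] [CompleteSpace Y]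
    (h : ∀ n : ℕ, 1 ≤ n → ¬ Embeds (NullSeq X) (Fin n → Y))
    (T : NullSeq X →L[ℝ] BoundedSeq Y) (B : BoundedSeq Y →L[ℝ] NullSeq X) :
    ¬ Function.LeftInverse B T := by
  intro hBT
  obtain ⟨u, hu1, hsum⟩ := exists_row_seq h T
  obtain ⟨S, hS⟩ := exists_clm_eq_tsum (w := fun k => T (NullSeq.row k (u k))) (norm_nonneg T)
    (fun a s => by
      simp only [← map_smul T, ← map_sum T]
      exact T.le_opNorm_of_le (NullSeq.norm_sum_smul_row_le (fun k => (hu1 k).le) (norm_nonneg a)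
        (lp.norm_apply_le_norm ENNReal.top_ne_zero a) s)) hsum
  choose n g hg hgu using fun k => NullSeq.exists_functional_apply_eq_one (hu1 k)
  obtain ⟨a, ha⟩ := exists_not_tendsto_of_eq_on_finite_support
    (fun k => (g k).comp ((NullSeq.eval (Nat.pair k (n k))).comp (B.comp S))) fun k a ha => by
      have hSa : S a = T (∑ l ∈ ha.toFinset, a l • NullSeq.row l (u l)) := by
        ext j
        rw [hS, tsum_eq_sum (s := ha.toFinset) fun l hl => by
          rw [Set.Finite.mem_toFinset, Function.mem_support, not_not] at hl
          rw [hl, zero_smul]]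
        simp only [map_sum, map_smul, lp.coeFn_sum, Finset.sum_apply, lp.coeFn_smul, Pi.smul_apply]
      have : B (S a) (Nat.pair k (n k)) = a k • u k (n k) := by
        rw [hSa, hBT, ← NullSeq.eval_apply, map_sum]
        simp only [map_smul, NullSeq.eval_apply, NullSeq.row_apply, Nat.unpair_pair, smul_ite,
          smul_zero, Finset.sum_ite_eq, Set.Finite.mem_toFinset, Function.mem_support]
        split_ifs with hk
        · rfl
        · rw [not_not.1 hk, zero_smul]
      show g k (B (S a) (Nat.pair k (n k))) = a k
      rw [this, map_smul, hgu, smul_eq_mul, mul_one]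
  apply ha
  -- The coordinates at which `B (S a)` is read are distinct, so its values there tend to zero.
  have hinj : Function.Injective fun k => Nat.pair k (n k) := fun k l hkl =>
    (Nat.pair_eq_pair.1 hkl).1
  have ht : Tendsto (fun k => 2 * ‖B (S a) (Nat.pair k (n k))‖) atTop (𝓝 0) := by
    rw [← Nat.cofinite_eq_atTop]
    simpa using (((B (S a)).tendsto_cofinite.comp hinj.tendsto_cofinite).norm).const_mul 2
  exact squeeze_zero_norm (fun k => (g k).le_of_opNorm_le (hg k) _) ht

theorem corollary4p2
    (X : Type*) [NormedAddCommGroup X] [NormedSpace ℝ X] [CompleteSpace X]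
    (Y : Type*) [NormedAddCommGroup Y] [NormedSpace ℝ Y] [CompleteSpace Y]
    (h : ∀ n : ℕ, 1 ≤ n → ¬ Embeds (NullSeq X) (Fin n → Y)) :
    ¬ EmbedsComplemented (NullSeq X) (BoundedSeq Y) := by
  rintro ⟨M, ⟨P, hP, rfl⟩, ⟨e⟩⟩
  refine not_leftInverse_nullSeq_boundedSeq h ((Submodule.subtypeL _).comp
      (e : NullSeq X →L[ℝ] (P : BoundedSeq Y →ₗ[ℝ] BoundedSeq Y).range))
    ((e.symm : (P : BoundedSeq Y →ₗ[ℝ] BoundedSeq Y).range →L[ℝ] NullSeq X).comp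
      (P.codRestrict (P : BoundedSeq Y →ₗ[ℝ] BoundedSeq Y).range fun v => ⟨v, rfl⟩)) fun u => ?_
  show e.symm ⟨P (e u), _⟩ = u
  rw [ContinuousLinearEquiv.symm_apply_eq]
  obtain ⟨v, hv⟩ := (e u).2
  refine Subtype.ext ?_
  show P (e u) = e u
  rw [← hv]
  exact hP v
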